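/- Let $q$ and $a$ be independent indeterminates. Write $(x;q)_k=\prod_{i=0}^{k-1}(1-xq^i)$ (with $(x;q)_0=1$), $(x_1,\ldots,x_m;q)_k=(x_1;q)_k\cdots(x_m;q)_k$, $[n]=1+q+\cdots+q^{n-1}$, and let $\Phi_n(q)$ be the $n$-th cyclotomic polynomial. For rational functions $A,B\in\mathbb{Q}(q,a)$ and a nonzero polynomial $P\in\mathbb{Q}[q,a]$, the congruence $A\equiv B\pmod P$ means that $A-B=PN/D$ for some polynomials $N,D\in\mathbb{Q}[q,a]$ with $D\neq0$ relatively prime to $P$. **Theorem.** Let $n$ be a positive odd integer, and for $k\geqslant 0$ let $$ c_q(k)=[4k+1]\frac{(aq,q/a;q^2)_k\,(q;q^2)_k^2}{(aq^2,q^2/a;q^2)_k\,(q^2;q^2)_k^2}. $$ Then $$ \sum_{k=0}^{n-1}\sum_{j=0}^{k}c_q(j)\,c_q(k-j)\equiv q^{1-n}[n]^2\pmod{[n]\,\Phi_n(q)\,(1-aq^n)(a-q^n)}. $$ -/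

import Mathlib

noncomputable section

namespace QSuper

/-- The `q`-shifted factorial `(x; q)_k = (1 - x)(1 - x q) ⋯ (1 - x q ^ (k - 1))`. -/
def qPoch {K : Type*} [CommRing K] (x q : K) (k : ℕ) : K :=
  ∏ i ∈ Finset.range k, (1 - x * q ^ i)

/-- The `q`-integer `[n] = 1 + q + ⋯ + q ^ (n - 1)`. -/
def qInt {K : Type*} [CommRing K] (q : K) (n : ℕ) : K :=
  ∑ i ∈ Finset.range n, q ^ i

/-- `[4k+1] (aq, q/a; q²)_k (q; q²)_k² / ((aq², q²/a; q²)_k (q²; q²)_k²)`. -/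
def cTerm {K : Type*} [Field K] (a q : K) (k : ℕ) : K :=
  qInt q (4 * k + 1) *
    ((qPoch (a * q) (q ^ 2) k * qPoch (q / a) (q ^ 2) k * qPoch q (q ^ 2) k ^ 2) /
      (qPoch (a * q ^ 2) (q ^ 2) k * qPoch (q ^ 2 / a) (q ^ 2) k *
        qPoch (q ^ 2) (q ^ 2) k ^ 2))

/-- Congruence of rational functions modulo a polynomial `m`: the difference `x - y` can be
written as `m * N / D` with polynomials `N` and `D ≠ 0` such that `D` is relatively prime to `m`,
i.e. `m` divides the numerator of `x - y` in lowest terms. -/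
def RatCongr {R : Type*} [CommRing R] [IsDomain R] (m : R) (x y : FractionRing R) : Prop :=
  ∃ N D : R, D ≠ 0 ∧ IsRelPrime D m ∧
    x - y = algebraMap R (FractionRing R) (m * N) / algebraMap R (FractionRing R) D

/-- The polynomial ring `ℚ[q][a]` in two independent indeterminates `q` (inner) and `a` (outer). -/
abbrev Poly : Type := Polynomial (Polynomial ℚ)

/-- The indeterminate `q` as a polynomial. -/
def qP : Poly := Polynomial.C Polynomial.X

/-- The indeterminate `a` as a polynomial. -/
def aP : Poly := Polynomial.X

/-- The field `ℚ(q, a)` of rational functions. -/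
abbrev Rat2 : Type := FractionRing Poly

/-- The indeterminate `q` as a rational function. -/
def qF : Rat2 := algebraMap Poly Rat2 qP

/-- The indeterminate `a` as a rational function. -/
def aF : Rat2 := algebraMap Poly Rat2 aP

/-- The polynomial `[n] Φ_n(q) (1 - a q ^ n) (a - q ^ n)`. -/
def modulus (n : ℕ) : Poly :=
  qInt qP n * Polynomial.aeval qP (Polynomial.cyclotomic n ℚ) * (1 - aP * qP ^ n) *
    (aP - qP ^ n)

end QSuper

end

/-! For `n > 1` the modulus is a product of pairwise relatively prime prime powers (`modulus_eq`),
so each can be treated alone, by specialising `a` or `q`. Write `n = 2N+1` and `c` for `cTerm`.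

At `a = q^n` or `a = q^(-n)` the terms `c(k)` with `k > N` vanish. The triangular double sum is then
the square of the single sum (`sum_triangle_eq_sq`), and the single sum equals `q^(-N)[n]` by a
recursion under `a ↦ a q²` (`sum_cTerm_eval`).

For `Φ_d` with `d = 2M+1 > 1` dividing `n`, let `q` be a primitive `d`-th root of unity and keep `a`
indeterminate. Then `c(ld+r) = w_l c(r)` for `r < d`, with `c(r) = 0` for `M < r < d` and `c(M-r) =
-c(r)` for `r ≤ M` (`cTerm_reverse`). Every block sums to zero, even if cut anywhere after its first
half, and this kills the double sum (`sum_triangle_eq_zero`).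

For the second factor `Φ_n`, the square of `(q;q²)_k` makes `c(k)` divisible by `Φ_n²` when `N < k <
n`. Modulo `Φ_n²` the double sum is the square of the half sum, itself divisible by `Φ_n`
(`divBy_two_sum_triangle`).

`EvalsTo` specialises fractions whose denominators survive, and `DivBy` records the resulting
divisibility. -/

noncomputable section

namespace QSuper

/-! ### Shifted factorials and Gaussian binomials. -/

section Pochhammer

variable {K : Type*} [CommRing K]

@[simp] lemma qPoch_zero (x q : K) : qPoch x q 0 = 1 := by simp [qPoch]

lemma qPoch_succ (x q : K) (k : ℕ) : qPoch x q (k + 1) = qPoch x q k * (1 - x * q ^ k) := by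
  simp [qPoch, Finset.prod_range_succ]

lemma qPoch_add (x q : K) (m k : ℕ) :
    qPoch x q (m + k) = qPoch x q m * qPoch (x * q ^ m) q k := by
  simp only [qPoch, Finset.prod_range_add]
  congr 1
  refine Finset.prod_congr rfl fun i _ => ?_
  rw [pow_add]; ring

lemma qInt_mul_one_sub (q : K) (n : ℕ) : qInt q n * (1 - q) = 1 - q ^ n := by
  exact geom_sum_mul_neg q n

/-- The Gaussian binomial coefficient is a polynomial. -/
lemma exists_gaussian (q : K) (m l : ℕ) :
    ∃ B : K, qPoch q q (m + l) = B * qPoch q q m * qPoch q q l := by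
  induction h : m + l generalizing m l with
  | zero =>
    obtain ⟨rfl, rfl⟩ : m = 0 ∧ l = 0 := by omega
    exact ⟨1, by simp⟩
  | succ s ih =>
    rcases m with _ | m
    · exact ⟨1, by simp [← h]⟩
    rcases l with _ | l
    · exact ⟨1, by simp [← h]⟩
    obtain ⟨B₁, h₁⟩ := ih m (l + 1) (by omega)
    obtain ⟨B₂, h₂⟩ := ih (m + 1) l (by omega)
    -- The `q`-Pascal rule.
    refine ⟨B₁ + q ^ (m + 1) * B₂, ?_⟩
    have hs : s = m + l + 1 := by omega
    have e₁ := qPoch_succ q q m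
    have e₂ := qPoch_succ q q l
    rw [qPoch_succ]
    have : (1 - q * q ^ s) = (1 - q * q ^ m) + q ^ (m + 1) * (1 - q * q ^ l) := by
      rw [hs]; ring
    rw [this, mul_add]
    nth_rewrite 1 [h₁]
    rw [h₂, e₁, e₂]
    ring

/-- `(q; q)_{2m} = (q; q²)_m (q²; q²)_m`. -/
lemma qPoch_two_mul (q : K) (m : ℕ) :
    qPoch q q (m + m) = qPoch q (q ^ 2) m * qPoch (q ^ 2) (q ^ 2) m := by
  induction m with
  | zero => simp
  | succ m ih =>
    rw [show m + 1 + (m + 1) = m + m + 1 + 1 by ring, qPoch_succ, qPoch_succ, ih, qPoch_succ,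
      qPoch_succ]
    ring

/-- `(q²; q²)_m = (q; q)_m (-q; q)_m`. -/
lemma qPoch_sq (q : K) (m : ℕ) :
    qPoch (q ^ 2) (q ^ 2) m = qPoch q q m * qPoch (-q) q m := by
  induction m with
  | zero => simp
  | succ m ih =>
    rw [qPoch_succ, qPoch_succ, qPoch_succ, ih]
    ring

lemma map_qPoch {S : Type*} [CommRing S] (f : K →+* S) (x q : K) (k : ℕ) :
    f (qPoch x q k) = qPoch (f x) (f q) k := by
  simp [qPoch]

lemma map_qInt {S : Type*} [CommRing S] (f : K →+* S) (q : K) (n : ℕ) :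
    f (qInt q n) = qInt (f q) n := by
  simp [qInt]

end Pochhammer

/-! ### Factorisation of the summand and its terminating evaluation. -/

section Ratio

variable {K : Type*} [Field K]

/-- The quotient `(a q; q²)_k / (a q²; q²)_k`. -/
def vRatio (a q : K) (k : ℕ) : K :=
  qPoch (a * q) (q ^ 2) k / qPoch (a * q ^ 2) (q ^ 2) k

@[simp] lemma vRatio_zero (a q : K) : vRatio a q 0 = 1 := by simp [vRatio]

lemma vRatio_add (a q : K) (m k : ℕ) :
    vRatio a q (m + k) = vRatio a q m * vRatio (a * q ^ (2 * m)) q k := by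
  simp only [vRatio, qPoch_add, mul_div_mul_comm]
  congr 3 <;> ring

lemma vRatio_succ (a q : K) (k : ℕ) :
    vRatio a q (k + 1) =
      vRatio a q k * ((1 - a * q ^ (2 * k + 1)) / (1 - a * q ^ (2 * k + 2))) := by
  rw [vRatio_add]
  congr 1
  simp only [vRatio, qPoch, Finset.prod_range_one]
  congr 1 <;> ring

lemma vRatio_succ' (a q : K) (k : ℕ) :
    vRatio a q (k + 1) = (1 - a * q) / (1 - a * q ^ 2) * vRatio (a * q ^ 2) q k := by
  rw [add_comm k 1, vRatio_add]
  simp [vRatio, qPoch]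

/-- The three ratios `vRatio` at `a`, `a⁻¹` and `1` can then be studied separately; the symmetry `a
↔ a⁻¹` becomes visible. -/
lemma cTerm_eq (a q : K) (k : ℕ) :
    cTerm a q k =
      qInt q (4 * k + 1) * (vRatio a q k * vRatio a⁻¹ q k * vRatio 1 q k ^ 2) := by
  have h₁ : q / a = a⁻¹ * q := by rw [div_eq_mul_inv, mul_comm]
  have h₂ : q ^ 2 / a = a⁻¹ * q ^ 2 := by rw [div_eq_mul_inv, mul_comm]
  rw [cTerm, vRatio, vRatio, vRatio, h₁, h₂, one_mul, one_mul]
  congr 1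
  rw [div_pow, div_mul_div_comm, div_mul_div_comm]

lemma cTerm_inv (a q : K) (k : ℕ) : cTerm a⁻¹ q k = cTerm a q k := by
  rw [cTerm_eq, cTerm_eq, inv_inv]; ring

/-- Telescoping identity relating the partial sums of `cTerm` at `a` and at `a q²`. -/
lemma sum_cTerm_telescope {a q : K} (ha : a ≠ 0) (hq : q ≠ 0)
    (h₁ : ∀ i : ℕ, 1 - q ^ (2 * i + 2) ≠ 0) (h₂ : ∀ i : ℕ, 1 - a * q ^ (2 * i + 2) ≠ 0)
    (h₃ : ∀ i : ℕ, a - q ^ (2 * i) ≠ 0) (j : ℕ) :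
    (1 - q) * (q * (1 - a) * ∑ k ∈ Finset.range (j + 1), cTerm (a * q ^ 2) q k -
      (1 - a * q ^ 2) * ∑ k ∈ Finset.range (j + 1), cTerm a q k) =
    -(1 + a * q) * (1 - q ^ (2 * j + 1)) ^ 2 *
      (vRatio (a * q ^ 2) q j * vRatio a⁻¹ q j * vRatio 1 q j ^ 2) := by
  induction j with
  | zero => simp [cTerm_eq, qInt]; ring
  | succ j ih =>
    have hI : qInt q (4 * (j + 1) + 1) * (1 - q) = 1 - q ^ (4 * (j + 1) + 1) :=
      qInt_mul_one_sub q _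
    have e₁ : vRatio (a * q ^ 2) q (j + 1) = vRatio (a * q ^ 2) q j *
        ((1 - a * q ^ 2 * q ^ (2 * j + 1)) / (1 - a * q ^ (2 * (j + 1) + 2))) := by
      rw [vRatio_succ]; congr 3; ring
    have e₂ : vRatio a⁻¹ q (j + 1) = vRatio a⁻¹ q j *
        ((a - q ^ (2 * j + 1)) / (a - q ^ (2 * (j + 1)))) := by
      rw [vRatio_succ]; congr 1
      rw [← mul_div_mul_left _ _ ha]
      congr 1
      · field_simp
      · field_simp; ring
    have e₃ : vRatio 1 q (j + 1) = vRatio 1 q j *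
        ((1 - q ^ (2 * j + 1)) / (1 - q ^ (2 * j + 2))) := by
      rw [vRatio_succ, one_mul, one_mul]
    -- Shifting `a` by `q²` costs one factor in each ratio, so the summands at `a` and at `a q²`
    -- share the ratios `U`, `V`, `W` at index `j`.
    have e₄ : vRatio a q (j + 1) = (1 - a * q) / (1 - a * q ^ 2) * vRatio (a * q ^ 2) q j :=
      vRatio_succ' a q j
    have e₅ : vRatio (a * q ^ 2)⁻¹ q (j + 1) = (a - q⁻¹) / (a - 1) * vRatio a⁻¹ q j := by
      rw [vRatio_succ']
      congr 1
      · rw [← mul_div_mul_left _ _ ha]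
        congr 1 <;> field_simp
      · congr 1; field_simp
    rw [Finset.sum_range_succ, Finset.sum_range_succ (fun k => cTerm a q k), cTerm_eq (a * q ^ 2),
      cTerm_eq a q (j + 1), e₅, e₄, e₁, e₂, e₃]
    have d₁ := h₁ j
    have d₂ := h₂ (j + 1)
    have d₃ := h₃ (j + 1)
    have d₄ : a - 1 ≠ 0 := by simpa using h₃ 0
    have d₅ : 1 - a * q ^ 2 ≠ 0 := by simpa using h₂ 0
    generalize ∑ k ∈ Finset.range (j + 1), cTerm (a * q ^ 2) q k = S₁ at *
    generalize ∑ k ∈ Finset.range (j + 1), cTerm a q k = S₂ at *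
    generalize vRatio (a * q ^ 2) q j = U at *
    generalize vRatio a⁻¹ q j = V at *
    generalize vRatio 1 q j = W at *
    generalize qInt q (4 * (j + 1) + 1) = I at *
    -- The new pair of summands equals the increment of the right-hand side from `j` to `j + 1`.
    have key : (q * (1 - a) * ((U * ((1 - a * q ^ 2 * q ^ (2 * j + 1)) /
        (1 - a * q ^ (2 * (j + 1) + 2)))) * ((a - q⁻¹) / (a - 1) * V) *
        (W * ((1 - q ^ (2 * j + 1)) / (1 - q ^ (2 * j + 2)))) ^ 2) -
        (1 - a * q ^ 2) * (((1 - a * q) / (1 - a * q ^ 2) * U) *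
        (V * ((a - q ^ (2 * j + 1)) / (a - q ^ (2 * (j + 1))))) *
        (W * ((1 - q ^ (2 * j + 1)) / (1 - q ^ (2 * j + 2)))) ^ 2)) *
        (1 - q ^ (4 * (j + 1) + 1)) =
        -(1 + a * q) * (1 - q ^ (2 * (j + 1) + 1)) ^ 2 *
        ((U * ((1 - a * q ^ 2 * q ^ (2 * j + 1)) / (1 - a * q ^ (2 * (j + 1) + 2)))) *
        (V * ((a - q ^ (2 * j + 1)) / (a - q ^ (2 * (j + 1))))) *
        (W * ((1 - q ^ (2 * j + 1)) / (1 - q ^ (2 * j + 2)))) ^ 2) +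
        (1 + a * q) * (1 - q ^ (2 * j + 1)) ^ 2 * (U * V * W ^ 2) := by
      have x₁ : q ^ (2 * j + 1) = (q ^ j) ^ 2 * q := by ring
      have x₅ : q ^ (2 * (j + 1) + 1) = (q ^ j) ^ 2 * q ^ 3 := by ring
      have x₆ : q ^ (4 * (j + 1) + 1) = (q ^ j) ^ 4 * q ^ 5 := by ring
      generalize hD₁ : 1 - q ^ (2 * j + 2) = D₁ at d₁ ⊢
      generalize hD₂ : 1 - a * q ^ (2 * (j + 1) + 2) = D₂ at d₂ ⊢
      generalize hD₃ : a - q ^ (2 * (j + 1)) = D₃ at d₃ ⊢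
      generalize hD₄ : a - 1 = D₄ at d₄ ⊢
      generalize hD₅ : 1 - a * q ^ 2 = D₅ at d₅ ⊢
      rw [x₁, x₅, x₆]
      field_simp
      rw [← hD₁, ← hD₂, ← hD₃, ← hD₄]
      ring
    rw [← hI] at key
    linear_combination ih + key

/-- The terminating very-well-poised sum at `a = q ^ (2N+1)`. -/
lemma sum_cTerm_eval {q : K} (hq : q ≠ 0) (hinj : Function.Injective fun i : ℕ => q ^ i) (N : ℕ) :
    (∀ k, N < k → cTerm (q ^ (2 * N + 1)) q k = 0) ∧
    q ^ N * ∑ k ∈ Finset.range (N + 1), cTerm (q ^ (2 * N + 1)) q k = qInt q (2 * N + 1) := by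
  -- The factor of index `N` in the numerator is `1 - q^(-(2N+1)) q^(2N+1)`.
  have hv : ∀ N k, N < k → vRatio (q ^ (2 * N + 1))⁻¹ q k = 0 := by
    intro N k hk
    rw [vRatio, qPoch, Finset.prod_eq_zero (Finset.mem_range.2 hk), zero_div]
    rw [sub_eq_zero, ← pow_mul]
    field_simp
    ring
  have h1 : ∀ i : ℕ, i ≠ 0 → 1 - q ^ i ≠ 0 := fun i hi h =>
    hi (hinj (by simpa using (sub_eq_zero.1 h).symm))
  have hc : ∀ N k, N < k → cTerm (q ^ (2 * N + 1)) q k = 0 := by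
    intro N k hk
    rw [cTerm_eq, hv N k hk]; ring
  refine ⟨hc N, ?_⟩
  induction N with
  | zero => simp [cTerm_eq, qInt]
  | succ N ih =>
    -- At `a = q^(2N+1)` and upper index `N + 1` the boundary term contains a vanishing ratio,
    -- leaving a two-term recursion in `N`.
    have ht := sum_cTerm_telescope (a := q ^ (2 * N + 1)) (pow_ne_zero _ hq) hq
      (fun i => h1 _ (by omega)) (fun i => by rw [← pow_add]; exact h1 _ (by omega))
      (fun i h => by have := hinj (sub_eq_zero.1 h); omega) (N + 1)
    rw [hv N (N + 1) (by omega), Finset.sum_range_succ (fun k => cTerm (q ^ (2 * N + 1)) q k),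
      hc N (N + 1) (by omega), ← pow_add, mul_zero, zero_mul, mul_zero, add_zero,
      mul_eq_zero, or_iff_right (by simpa using h1 1 one_ne_zero)] at ht
    have i₁ := qInt_mul_one_sub q (2 * N + 1)
    have i₂ := qInt_mul_one_sub q (2 * (N + 1) + 1)
    have n₀ : 1 - q ≠ 0 := by simpa using h1 1 one_ne_zero
    have n₁ := h1 (2 * N + 1) (by omega)
    apply mul_right_cancel₀ n₀
    apply mul_right_cancel₀ n₁
    rw [i₂]
    rw [show 2 * N + 1 + 2 = 2 * (N + 1) + 1 by ring] at ht
    generalize ∑ k ∈ Finset.range (N + 1 + 1), cTerm (q ^ (2 * (N + 1) + 1)) q k = S at *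
    generalize ∑ k ∈ Finset.range (N + 1), cTerm (q ^ (2 * N + 1)) q k = S' at *
    rw [← ih] at i₁
    linear_combination q ^ N * (1 - q) * ht + (1 - q ^ (2 * (N + 1) + 1)) * i₁

end Ratio

/-! ### Reflection and vanishing at roots of unity of odd order. -/

section RootOfUnity

variable {K : Type*} [Field K]

/-- Reversal of `vRatio` at a root of unity of odd order `2N + 1`. -/
lemma vRatio_reverse {a q : K} (ha : a ≠ 0) (hq : q ≠ 0) {N : ℕ} (hN : q ^ (2 * N + 1) = 1)
    (h₁ : ∀ i < N, 1 - a * q ^ (2 * i + 1) ≠ 0) (h₂ : ∀ i < N, 1 - a * q ^ (2 * i + 2) ≠ 0)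
    (k m : ℕ) (hkm : m + k = N) :
    vRatio a q m = vRatio a q N * q ^ k * vRatio a⁻¹ q k := by
  induction k generalizing m with
  | zero => obtain rfl : m = N := by omega
            simp
  | succ k ih =>
    have h := ih (m + 1) (by omega)
    rw [vRatio_succ] at h
    rw [vRatio_succ]
    have d₁ := h₁ m (by omega)
    have d₂ := h₂ m (by omega)
    -- Since `m + k + 1 = N`, the exponents of reflected factors add up to `2N + 1`; numerator
    -- factors turn into denominator factors.
    have p₁ : q ^ (2 * m + 1) * q ^ (2 * k + 2) = 1 := by
      rw [← pow_add, ← hN]; congr 1; omega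
    have p₂ : q ^ (2 * m + 2) * q ^ (2 * k + 1) = 1 := by
      rw [← pow_add, ← hN]; congr 1; omega
    have e₁ : 1 - a⁻¹ * q ^ (2 * k + 2) = -a⁻¹ * q ^ (2 * k + 2) * (1 - a * q ^ (2 * m + 1)) := by
      linear_combination -(a⁻¹ * a) * p₁ - mul_inv_cancel₀ ha
    have e₂ : 1 - a⁻¹ * q ^ (2 * k + 1) = -a⁻¹ * q ^ (2 * k + 1) * (1 - a * q ^ (2 * m + 2)) := by
      linear_combination -(a⁻¹ * a) * p₂ - mul_inv_cancel₀ ha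
    rw [e₁, e₂]
    generalize 1 - a * q ^ (2 * m + 1) = D₁ at *
    generalize 1 - a * q ^ (2 * m + 2) = D₂ at *
    have : vRatio a q m = (vRatio a q m * (D₁ / D₂)) * (D₂ / D₁) := by field_simp
    rw [this, h]
    field_simp
    ring

lemma one_sub_inv_mul_pow_ne_zero {a q : K} (ha : a ≠ 0) (h : ∀ i : ℕ, a ≠ q ^ i) (i : ℕ) :
    1 - a⁻¹ * q ^ i ≠ 0 := fun h₀ =>
  h i ((inv_mul_eq_one₀ ha).1 (sub_eq_zero.1 h₀).symm)

/-- Inverse powers of a root of unity are also nonnegative powers, so the hypothesis on `a` excludes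
them too. -/
lemma one_sub_mul_pow_ne_zero {a q : K} {d : ℕ} (hd : IsPrimitiveRoot q d) (hd0 : 0 < d)
    (h : ∀ i : ℕ, a ≠ q ^ i) (i : ℕ) : 1 - a * q ^ i ≠ 0 := fun h₀ => by
  apply h (d * i - i)
  have e : q ^ (d * i - i) * q ^ i = 1 := by
    rw [← pow_add, Nat.sub_add_cancel (by nlinarith), pow_mul, hd.pow_eq_one, one_pow]
  apply mul_right_cancel₀ (pow_ne_zero i (hd.ne_zero hd0.ne'))
  rw [e, (sub_eq_zero.1 h₀).symm]

lemma one_sub_pow_ne_zero_of_odd {q : K} {d : ℕ} (hd : IsPrimitiveRoot q d) (hodd : Odd d)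
    {i : ℕ} (hi : i < d - 1) : 1 - q ^ (2 * i + 2) ≠ 0 := fun h => by
  have h₁ := (hd.pow_eq_one_iff_dvd _).1 (sub_eq_zero.1 h).symm
  rw [show 2 * i + 2 = 2 * (i + 1) by ring] at h₁
  have h₂ := Nat.le_of_dvd (by omega) (((Nat.coprime_two_right).2 hodd).dvd_of_dvd_mul_left h₁)
  omega

lemma one_sub_ne_zero_of_isPrimitiveRoot {q : K} {d : ℕ} (hd : IsPrimitiveRoot q d)
    (hd1 : 1 < d) : 1 - q ≠ 0 := fun h =>
  hd.pow_ne_one_of_pos_of_lt one_ne_zero hd1 (by rw [pow_one]; exact (sub_eq_zero.1 h).symm)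

lemma qInt_eq_zero_of_isPrimitiveRoot {q : K} {d : ℕ} (hd : IsPrimitiveRoot q d) (hd1 : 1 < d)
    {n : ℕ} (hn : d ∣ n) : qInt q n = 0 := by
  apply mul_right_cancel₀ (one_sub_ne_zero_of_isPrimitiveRoot hd hd1)
  rw [qInt_mul_one_sub, (hd.pow_eq_one_iff_dvd n).2 hn, sub_self, zero_mul]

lemma vRatio_one_eq_zero_of_lt {q : K} {N k : ℕ} (hN : q ^ (2 * N + 1) = 1) (hk : N < k) :
    vRatio 1 q k = 0 := by
  rw [vRatio, qPoch, Finset.prod_eq_zero (Finset.mem_range.2 hk), zero_div]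
  rw [sub_eq_zero, one_mul, ← hN]
  ring

/-- Antisymmetry of `cTerm` at a root of unity of odd order `2N + 1`. -/
lemma cTerm_reverse {a q : K} (ha : a ≠ 0) {N : ℕ} (hN : IsPrimitiveRoot q (2 * N + 1))
    (hN0 : N ≠ 0) (h : ∀ i : ℕ, a ≠ q ^ i) {k m : ℕ} (hkm : m + k = N) :
    cTerm a q m = - cTerm a q k := by
  have hq : q ≠ 0 := hN.ne_zero (by omega)
  have hone : ∀ i : ℕ, 0 < i → i < 2 * N + 1 → 1 - q ^ i ≠ 0 := fun i h₀ h₁ h₂ =>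
    hN.pow_ne_one_of_pos_of_lt h₀.ne' h₁ (sub_eq_zero.1 h₂).symm
  have hq1 := hN.pow_eq_one
  have hinv := one_sub_inv_mul_pow_ne_zero ha h
  have hmul := one_sub_mul_pow_ne_zero hN (by omega) h
  have r₁ := vRatio_reverse ha hq hq1 (fun i _ => hmul _) (fun i _ => hmul _)
  have r₂ := vRatio_reverse (inv_ne_zero ha) hq hq1 (fun i _ => hinv _) (fun i _ => hinv _)
  have r₃ := vRatio_reverse (one_ne_zero (α := K)) hq hq1
    (fun i _ => by rw [one_mul]; exact hone _ (by omega) (by omega))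
    (fun i _ => by rw [one_mul]; exact hone _ (by omega) (by omega))
  rw [inv_inv] at r₂
  rw [inv_one] at r₃
  have t₁ := r₁ N 0 (by omega)
  have t₃ := r₃ N 0 (by omega)
  rw [vRatio_zero] at t₁ t₃
  rw [cTerm_eq, cTerm_eq, r₁ k m hkm, r₂ k m hkm, r₃ k m hkm]
  have hI := qInt_mul_one_sub q (4 * m + 1)
  have hI' := qInt_mul_one_sub q (4 * k + 1)
  have hm : q ^ (4 * m + 1) * q ^ (4 * k + 1) = 1 := by
    rw [← pow_add, show 4 * m + 1 + (4 * k + 1) = (2 * N + 1) * 2 by omega, pow_mul, hq1, one_pow]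
  have n₀ := one_sub_ne_zero_of_isPrimitiveRoot hN (by omega)
  -- The two exponents sum to `2(2N+1)`; the minus sign of the antisymmetry comes from here.
  have hII : qInt q (4 * m + 1) * q ^ (4 * k + 1) = - qInt q (4 * k + 1) := by
    apply mul_right_cancel₀ n₀
    linear_combination q ^ (4 * k + 1) * hI + hI' - hm
  -- Reversing the whole range (`m = 0`, `k = N`) gives the product as `q^(-2N)`, which is `q`.
  have hc : vRatio a q N * vRatio a⁻¹ q N * vRatio 1 q N ^ 2 = q := by
    have e : (q ^ N) ^ 2 * q = 1 := by rw [← hq1]; ring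
    apply mul_left_cancel₀ (pow_ne_zero 2 (pow_ne_zero N hq))
    rw [e]
    linear_combination (-1 : K) * t₃ - (vRatio 1 q N ^ 2 * q ^ N) * t₁
  generalize vRatio a q N = A at *
  generalize vRatio a⁻¹ q N = B at *
  generalize vRatio 1 q N = C at *
  generalize vRatio a q k = A' at *
  generalize vRatio a⁻¹ q k = B' at *
  generalize vRatio 1 q k = C' at *
  linear_combination (qInt q (4 * m + 1) * q ^ (4 * k) * A' * B' * C' ^ 2) * hc +
    (A' * B' * C' ^ 2) * hII

/-- `cTerm` vanishes in the second half of the period. -/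
lemma cTerm_eq_zero_of_lt {a q : K} {N k : ℕ} (hN : q ^ (2 * N + 1) = 1) (hk : N < k) :
    cTerm a q k = 0 := by
  rw [cTerm_eq, vRatio_one_eq_zero_of_lt hN hk]; ring

lemma sum_cTerm_eq_zero [CharZero K] {a q : K} (ha : a ≠ 0) {N : ℕ}
    (hN : IsPrimitiveRoot q (2 * N + 1)) (hN0 : N ≠ 0) (h : ∀ i : ℕ, a ≠ q ^ i) :
    ∑ k ∈ Finset.range (N + 1), cTerm a q k = 0 := by
  have e := Finset.sum_range_reflect (fun k => cTerm a q k) (N + 1)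
  rw [Finset.sum_congr rfl (g := fun k => - cTerm a q k), Finset.sum_neg_distrib] at e
  · exact self_eq_neg.1 e.symm
  · intro k hk
    rw [Finset.mem_range] at hk
    exact cTerm_reverse ha hN hN0 h (by omega)

end RootOfUnity

/-! ### Triangular double sums of sequences with vanishing half-periods. -/

section DoubleSum

variable {R : Type*} [CommRing R]

/-- Reindexing by `i = k - j` isolates a partial sum of `E`, whose length decides everything below.
-/
lemma sum_triangle (E : ℕ → R) (n : ℕ) :
    ∑ k ∈ Finset.range n, ∑ j ∈ Finset.range (k + 1), E j * E (k - j) =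
      ∑ j ∈ Finset.range n, E j * ∑ i ∈ Finset.range (n - j), E i := by
  simp_rw [Finset.mul_sum]
  rw [Finset.range_eq_Ico, Finset.sum_sigma', Finset.sum_sigma']
  refine Finset.sum_bij' (fun x _ => ⟨x.2, x.1 - x.2⟩) (fun x _ => ⟨x.1 + x.2, x.1⟩) ?_ ?_ ?_ ?_ ?_
  all_goals
    rintro ⟨x, y⟩ h
    simp only [Finset.mem_sigma, Finset.mem_range, Finset.mem_Ico] at h ⊢
  · omega
  · omega
  · congr 1; omega
  · congr 1; omega

lemma sum_range_eq_of_zero {E : ℕ → R} {m l : ℕ} (hml : m ≤ l)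
    (hE : ∀ i, m ≤ i → i < l → E i = 0) :
    ∑ i ∈ Finset.range l, E i = ∑ i ∈ Finset.range m, E i := by
  symm
  refine Finset.sum_subset (Finset.range_mono hml) fun i hi hi' => ?_
  rw [Finset.mem_range] at hi hi'
  exact hE i (by omega) hi

/-- If `E` vanishes on the second half of `[0, 2N]` the triangular double sum is a square. -/
lemma sum_triangle_eq_sq {E : ℕ → R} {N : ℕ} (hE : ∀ i, N < i → i < 2 * N + 1 → E i = 0) :
    ∑ k ∈ Finset.range (2 * N + 1), ∑ j ∈ Finset.range (k + 1), E j * E (k - j) =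
      (∑ j ∈ Finset.range (N + 1), E j) ^ 2 := by
  rw [sum_triangle, sum_range_eq_of_zero (m := N + 1) (by omega), pow_two, Finset.sum_mul]
  · refine Finset.sum_congr rfl fun j hj => ?_
    rw [Finset.mem_range] at hj
    congr 1
    exact sum_range_eq_of_zero (by omega) fun i h₁ h₂ => hE i (by omega) (by omega)
  · intro i h₁ h₂
    rw [hE i (by omega) h₂, zero_mul]

/-- If `E (l d + r) = w l * e r`, with `e` vanishing on the second half of the period and of sum
zero over the period, then the triangular double sum over a multiple of the period is zero. -/
lemma sum_triangle_eq_zero {w e : ℕ → R} {N d : ℕ} (hd : d = 2 * N + 1)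
    (he : ∀ i, N < i → i < d → e i = 0) (hsum : ∑ i ∈ Finset.range (N + 1), e i = 0) (l : ℕ) :
    ∑ k ∈ Finset.range (l * d), ∑ j ∈ Finset.range (k + 1),
      (w (j / d) * e (j % d)) * (w ((k - j) / d) * e ((k - j) % d)) = 0 := by
  rw [sum_triangle (fun i => w (i / d) * e (i % d))]
  have hd0 : 0 < d := by omega
  have hshift : ∀ u i, i < d → (u * d + i) / d = u ∧ (u * d + i) % d = i := fun u i hi => by
    rw [mul_comm u d]
    exact ⟨by rw [Nat.mul_add_div hd0, Nat.div_eq_of_lt hi, add_zero],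
      by rw [Nat.mul_add_mod, Nat.mod_eq_of_lt hi]⟩
  have hpart : ∀ u r, N < r → r ≤ d → ∑ i ∈ Finset.range r,
      (w ((u * d + i) / d) * e ((u * d + i) % d)) = 0 := fun u r h₁ h₂ => by
    rw [Finset.sum_congr rfl (g := fun i => w u * e i), ← Finset.mul_sum,
      sum_range_eq_of_zero (m := N + 1) h₁ (fun i h h' => he i (by omega) (by omega)), hsum,
      mul_zero]
    intro i hi
    rw [Finset.mem_range] at hi
    rw [(hshift u i (by omega)).1, (hshift u i (by omega)).2]
  have hfull : ∀ u, ∑ i ∈ Finset.range (u * d), w (i / d) * e (i % d) = 0 := fun u => by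
    induction u with
    | zero => simp
    | succ u ih =>
      rw [add_mul, one_mul, Finset.sum_range_add, ih, hpart u d (by omega) le_rfl, add_zero]
  refine Finset.sum_eq_zero fun j hj => ?_
  rw [Finset.mem_range] at hj
  have hdm := Nat.div_add_mod' j d
  have hlt := Nat.mod_lt j hd0
  have hul : j / d < l := Nat.div_lt_of_lt_mul (by rwa [mul_comm])
  generalize j / d = u at *
  generalize j % d = r at *
  by_cases hr : N < r
  · rw [he r hr hlt, mul_zero, zero_mul]
  · obtain ⟨s, rfl⟩ : ∃ s, l = u + 1 + s := ⟨l - (u + 1), by omega⟩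
    -- For `r ≤ N` the inner sum consists of `s` full blocks and a piece of length `d - r > N`,
    -- which contains the whole support of `e`.
    have : (u + 1 + s) * d - j = s * d + (d - r) := by
      rw [← hdm, Nat.sub_eq_iff_eq_add (by nlinarith)]
      have : (u + 1 + s) * d = u * d + d + s * d := by ring
      omega
    rw [this, Finset.sum_range_add, hfull, hpart s (d - r) (by omega) (by omega), add_zero,
      mul_zero]

end DoubleSum

open Polynomial

/-! ### Specialisation of fractions along a ring homomorphism. -/

section Evaluation

variable {R F L : Type*} [CommRing R] [Field F] [Algebra R F] [Field L]

/-- `x` is a quotient of elements of `R` whose denominator is not killed by `φ`, and its image under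
the extension of `φ` to such quotients is `v`. -/
def EvalsTo (φ : R →+* L) (x : F) (v : L) : Prop :=
  ∃ N D : R, φ D ≠ 0 ∧ x * algebraMap R F D = algebraMap R F N ∧ v * φ D = φ N

variable {φ : R →+* L} {x y : F} {v w : L}

lemma evalsTo_algebraMap (φ : R →+* L) (r : R) : EvalsTo φ (algebraMap R F r) (φ r) :=
  ⟨r, 1, by simp, by simp, by simp⟩

lemma evalsTo_one (φ : R →+* L) : EvalsTo φ (1 : F) 1 := ⟨1, 1, by simp, by simp, by simp⟩

lemma evalsTo_zero (φ : R →+* L) : EvalsTo φ (0 : F) 0 := ⟨0, 1, by simp, by simp, by simp⟩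

lemma EvalsTo.add (hx : EvalsTo φ x v) (hy : EvalsTo φ y w) : EvalsTo φ (x + y) (v + w) := by
  obtain ⟨N, D, h₀, h₁, h₂⟩ := hx
  obtain ⟨N', D', h₀', h₁', h₂'⟩ := hy
  refine ⟨N * D' + N' * D, D * D', by simp [h₀, h₀'], ?_, ?_⟩
  · simp only [map_mul, map_add, ← h₁, ← h₁']; ring
  · simp only [map_mul, map_add, ← h₂, ← h₂']; ring

lemma EvalsTo.mul (hx : EvalsTo φ x v) (hy : EvalsTo φ y w) : EvalsTo φ (x * y) (v * w) := by
  obtain ⟨N, D, h₀, h₁, h₂⟩ := hx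
  obtain ⟨N', D', h₀', h₁', h₂'⟩ := hy
  refine ⟨N * N', D * D', by simp [h₀, h₀'], ?_, ?_⟩
  · simp only [map_mul, ← h₁, ← h₁']; ring
  · simp only [map_mul, ← h₂, ← h₂']; ring

lemma EvalsTo.pow (hx : EvalsTo φ x v) (k : ℕ) : EvalsTo φ (x ^ k) (v ^ k) := by
  induction k with
  | zero => simpa using evalsTo_one φ
  | succ k ih => rw [pow_succ, pow_succ]; exact ih.mul hx

lemma EvalsTo.neg (hx : EvalsTo φ x v) : EvalsTo φ (-x) (-v) := by
  obtain ⟨N, D, h₀, h₁, h₂⟩ := hx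
  exact ⟨-N, D, h₀, by simp [h₁], by simp [h₂]⟩

lemma EvalsTo.sub (hx : EvalsTo φ x v) (hy : EvalsTo φ y w) : EvalsTo φ (x - y) (v - w) := by
  rw [sub_eq_add_neg, sub_eq_add_neg]; exact hx.add hy.neg

lemma EvalsTo.sum {s : Finset ℕ} {f : ℕ → F} {g : ℕ → L} (h : ∀ i ∈ s, EvalsTo φ (f i) (g i)) :
    EvalsTo φ (∑ i ∈ s, f i) (∑ i ∈ s, g i) := by
  induction s using Finset.cons_induction with
  | empty => simpa using evalsTo_zero φ
  | cons i s hi ih =>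
    rw [Finset.sum_cons, Finset.sum_cons]
    exact (h i (by simp)).add (ih fun j hj => h j (by simp [hj]))

lemma EvalsTo.prod {s : Finset ℕ} {f : ℕ → F} {g : ℕ → L} (h : ∀ i ∈ s, EvalsTo φ (f i) (g i)) :
    EvalsTo φ (∏ i ∈ s, f i) (∏ i ∈ s, g i) := by
  induction s using Finset.cons_induction with
  | empty => simpa using evalsTo_one φ
  | cons i s hi ih =>
    rw [Finset.prod_cons, Finset.prod_cons]
    exact (h i (by simp)).mul (ih fun j hj => h j (by simp [hj]))

lemma EvalsTo.qPoch (hx : EvalsTo φ x v) (hy : EvalsTo φ y w) (k : ℕ) :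
    EvalsTo φ (qPoch x y k) (qPoch v w k) :=
  EvalsTo.prod fun i _ => (evalsTo_one φ).sub (hx.mul (hy.pow i))

lemma EvalsTo.qInt (hx : EvalsTo φ x v) (k : ℕ) : EvalsTo φ (qInt x k) (qInt v k) :=
  EvalsTo.sum fun i _ => hx.pow i

variable [IsFractionRing R F]

lemma EvalsTo.inv (hx : EvalsTo φ x v) (hv : v ≠ 0) : EvalsTo φ x⁻¹ v⁻¹ := by
  obtain ⟨N, D, h₀, h₁, h₂⟩ := hx
  have hN : φ N ≠ 0 := by rw [← h₂]; exact mul_ne_zero hv h₀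
  have hN' : algebraMap R F N ≠ 0 := by
    rw [Ne, map_eq_zero_iff _ (IsFractionRing.injective R F)]
    rintro rfl
    exact hN (map_zero φ)
  have hx : x ≠ 0 := by rintro rfl; exact hN' (by rw [← h₁, zero_mul])
  exact ⟨D, N, hN, by rw [← h₁]; field_simp, by rw [← h₂]; field_simp⟩

lemma EvalsTo.div (hx : EvalsTo φ x v) (hy : EvalsTo φ y w) (hw : w ≠ 0) :
    EvalsTo φ (x / y) (v / w) := by
  rw [div_eq_mul_inv, div_eq_mul_inv]; exact hx.mul (hy.inv hw)

lemma EvalsTo.zpow (hx : EvalsTo φ x v) (hv : v ≠ 0) (k : ℤ) : EvalsTo φ (x ^ k) (v ^ k) := by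
  cases k with
  | ofNat k => simpa using hx.pow k
  | negSucc k => simpa using (hx.pow (k + 1)).inv (pow_ne_zero _ hv)

lemma EvalsTo.vRatio (hx : EvalsTo φ x v) (hy : EvalsTo φ y w) {k : ℕ}
    (h : ∀ i < k, 1 - v * w ^ (2 * i + 2) ≠ 0) :
    EvalsTo φ (vRatio x y k) (vRatio v w k) := by
  refine ((hx.mul hy).qPoch (hy.pow 2) k).div ((hx.mul (hy.pow 2)).qPoch (hy.pow 2) k) ?_
  refine Finset.prod_ne_zero_iff.2 fun i hi => ?_
  convert h i (Finset.mem_range.1 hi) using 2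
  ring

lemma EvalsTo.cTerm (hx : EvalsTo φ x v) (hy : EvalsTo φ y w) (hv : v ≠ 0) {k : ℕ}
    (h₁ : ∀ i < k, 1 - v * w ^ (2 * i + 2) ≠ 0) (h₂ : ∀ i < k, 1 - v⁻¹ * w ^ (2 * i + 2) ≠ 0)
    (h₃ : ∀ i < k, 1 - w ^ (2 * i + 2) ≠ 0) :
    EvalsTo φ (cTerm x y k) (cTerm v w k) := by
  rw [cTerm_eq, cTerm_eq]
  exact (hy.qInt _).mul (((hx.vRatio hy h₁).mul ((hx.inv hv).vRatio hy h₂)).mul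
    (((evalsTo_one φ).vRatio hy (by simpa using h₃)).pow 2))

variable [IsDomain R]

/-- The ratio `(q; q²)_m / (q²; q²)_m` can be evaluated at every root of unity of odd order. -/
lemma exists_evalsTo_vRatio_one {r : R} (hr : ∀ m : ℕ, 0 < m → r ^ m ≠ 1)
    (h : ∀ m : ℕ, 1 + φ r ^ m ≠ 0) (m : ℕ) :
    ∃ v, EvalsTo φ (QSuper.vRatio (1 : F) (algebraMap R F r) m) v := by
  obtain ⟨B, hB⟩ := exists_gaussian r m m
  have hP : ∀ s : R, (∀ i : ℕ, 1 - s * r ^ i ≠ 0) → QSuper.qPoch s r m ≠ 0 := fun s hs =>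
    Finset.prod_ne_zero_iff.2 fun i _ => hs i
  have hneg : φ (QSuper.qPoch (-r) r m) ≠ 0 := by
    rw [map_qPoch]
    refine Finset.prod_ne_zero_iff.2 fun i _ => ?_
    convert h (i + 1) using 1
    rw [map_neg, pow_succ]; ring
  have hneg' : QSuper.qPoch (-r) r m ≠ 0 := fun h => hneg (by rw [h, map_zero])
  have hpos : QSuper.qPoch r r m ≠ 0 := hP r fun i hi => hr (i + 1) (by omega) (by
    rw [pow_succ', ← sub_eq_zero.1 hi])
  have e₁ := qPoch_two_mul r m
  have e₂ := qPoch_sq r m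
  -- Thus the ratio is the central Gaussian binomial over `(-q;q)_m²`; the factors `(q;q)_m`, which
  -- may vanish under `φ`, have cancelled.
  have key : QSuper.qPoch r (r ^ 2) m * QSuper.qPoch (-r) r m ^ 2 =
      B * QSuper.qPoch (r ^ 2) (r ^ 2) m := by
    rw [hB, e₂] at e₁
    rw [e₂]
    apply mul_right_cancel₀ hpos
    linear_combination (- QSuper.qPoch (-r) r m) * e₁
  have hval : QSuper.vRatio (1 : F) (algebraMap R F r) m =
      algebraMap R F B / algebraMap R F (QSuper.qPoch (-r) r m ^ 2) := by
    have i := IsFractionRing.injective R F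
    rw [QSuper.vRatio, one_mul, one_mul, ← map_pow, ← map_qPoch, ← map_qPoch, div_eq_div_iff,
      ← map_mul, ← map_mul, key]
    · rw [Ne, map_eq_zero_iff _ i, e₂]; exact mul_ne_zero hpos hneg'
    · rw [Ne, map_eq_zero_iff _ i]; exact pow_ne_zero _ hneg'
  rw [hval]
  exact ⟨_, (evalsTo_algebraMap φ _).div (evalsTo_algebraMap φ _)
    (by rw [map_pow]; exact pow_ne_zero _ hneg)⟩

end Evaluation

/-! ### Valuations at a prime and reduction of the congruence to prime powers. -/

section DivBy

variable {R : Type*} [CommRing R]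

/-- The `p`-adic valuation of the fraction `x` is at least `e`. -/
def DivBy (p : R) (e : ℕ) (x : FractionRing R) : Prop :=
  ∃ N D : R, ¬ p ∣ D ∧ x * algebraMap R (FractionRing R) D =
    algebraMap R (FractionRing R) (p ^ e * N)

variable {p : R} {e e' : ℕ} {x y : FractionRing R}

lemma DivBy.mul (hp : Prime p) (hx : DivBy p e x) (hy : DivBy p e' y) :
    DivBy p (e + e') (x * y) := by
  obtain ⟨N, D, h₀, h₁⟩ := hx
  obtain ⟨N', D', h₀', h₁'⟩ := hy
  refine ⟨N * N', D * D', fun h => (hp.dvd_or_dvd h).elim h₀ h₀', ?_⟩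
  rw [map_mul, show p ^ (e + e') * (N * N') = p ^ e * N * (p ^ e' * N') by ring, map_mul, ← h₁,
    ← h₁']
  ring

lemma DivBy.add (hp : Prime p) (hx : DivBy p e x) (hy : DivBy p e y) : DivBy p e (x + y) := by
  obtain ⟨N, D, h₀, h₁⟩ := hx
  obtain ⟨N', D', h₀', h₁'⟩ := hy
  refine ⟨N * D' + N' * D, D * D', fun h => (hp.dvd_or_dvd h).elim h₀ h₀', ?_⟩
  rw [map_mul, show p ^ e * (N * D' + N' * D) = p ^ e * N * D' + p ^ e * N' * D by ring, map_add,
    map_mul _ _ D', map_mul _ _ D, ← h₁, ← h₁']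
  ring

lemma DivBy.neg (hx : DivBy p e x) : DivBy p e (-x) := by
  obtain ⟨N, D, h₀, h₁⟩ := hx
  exact ⟨-N, D, h₀, by rw [neg_mul, h₁, mul_neg, map_neg]⟩

lemma DivBy.sub (hp : Prime p) (hx : DivBy p e x) (hy : DivBy p e y) : DivBy p e (x - y) := by
  rw [sub_eq_add_neg]; exact hx.add hp hy.neg

lemma DivBy.zero (hp : Prime p) : DivBy p e 0 := ⟨0, 1, hp.not_dvd_one, by simp⟩

lemma DivBy.sum (hp : Prime p) {s : Finset ℕ} {f : ℕ → FractionRing R}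
    (h : ∀ i ∈ s, DivBy p e (f i)) : DivBy p e (∑ i ∈ s, f i) := by
  induction s using Finset.cons_induction with
  | empty => simpa using DivBy.zero hp
  | cons i s hi ih =>
    rw [Finset.sum_cons]
    exact (h i (by simp)).add hp (ih fun j hj => h j (by simp [hj]))

/-- Divisibility of the triangular double sum by `p²` when the second half of the terms is divisible
by `p²` and the sum of the first half is divisible by `p`. -/
lemma divBy_two_sum_triangle (hp : Prime p) {c : ℕ → FractionRing R} {N : ℕ}
    (hint : ∀ k ≤ N, DivBy p 0 (c k)) (htwo : ∀ k, N < k → k < 2 * N + 1 → DivBy p 2 (c k))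
    (hS : DivBy p 1 (∑ k ∈ Finset.range (N + 1), c k)) :
    DivBy p 2 (∑ k ∈ Finset.range (2 * N + 1), ∑ j ∈ Finset.range (k + 1), c j * c (k - j)) := by
  -- Truncating `c` beyond `N` makes the double sum an exact square. As `k ≤ 2N`, at most one of
  -- `j`, `k - j` exceeds `N`, so each discarded product is a multiple of `p²` times an integral
  -- term.
  obtain ⟨E, hlow, hhigh⟩ : ∃ E : ℕ → FractionRing R, (∀ k ≤ N, E k = c k) ∧
      ∀ k, N < k → E k = 0 :=
    ⟨fun k => if k ≤ N then c k else 0, fun k hk => if_pos hk, fun k hk => if_neg (by omega)⟩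
  have hsq : DivBy p 2 (∑ k ∈ Finset.range (2 * N + 1), ∑ j ∈ Finset.range (k + 1),
      E j * E (k - j)) := by
    rw [sum_triangle_eq_sq fun i hi _ => hhigh i hi, Finset.sum_congr rfl
      fun i hi => hlow i (by rw [Finset.mem_range] at hi; omega), pow_two]
    exact hS.mul hp hS
  have hdiff : DivBy p 2 (∑ k ∈ Finset.range (2 * N + 1), ∑ j ∈ Finset.range (k + 1),
      (c j * c (k - j) - E j * E (k - j))) := by
    refine DivBy.sum hp fun k hk => DivBy.sum hp fun j hj => ?_
    rw [Finset.mem_range] at hk hj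
    by_cases h₁ : j ≤ N
    · by_cases h₂ : k - j ≤ N
      · rw [hlow j h₁, hlow _ h₂, sub_self]
        exact DivBy.zero hp
      · rw [hhigh (k - j) (by omega), mul_zero, sub_zero]
        exact (hint j h₁).mul hp (htwo (k - j) (by omega) (by omega))
    · rw [hhigh j (by omega), zero_mul, sub_zero]
      exact (htwo j (by omega) (by omega)).mul hp (hint (k - j) (by omega))
  have := hdiff.add hp hsq
  simpa only [Finset.sum_sub_distrib, sub_add_cancel] using this

variable [IsDomain R] {L : Type*} [Field L] {φ : R →+* L} {v : L}

lemma EvalsTo.divBy_zero (hp : φ p = 0) (hx : EvalsTo φ x v) : DivBy p 0 x := by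
  obtain ⟨N, D, h₀, h₁, -⟩ := hx
  refine ⟨N, D, ?_, by simpa using h₁⟩
  rintro ⟨c, rfl⟩
  exact h₀ (by rw [map_mul, hp, zero_mul])

/-- When `p` generates the kernel of `φ`, a zero value forces `p` into the numerator while the
denominator stays prime to `p`. -/
lemma EvalsTo.divBy_one (hp : φ p = 0) (hker : ∀ r, φ r = 0 → p ∣ r) (hx : EvalsTo φ x 0) :
    DivBy p 1 x := by
  obtain ⟨N, D, h₀, h₁, h₂⟩ := hx
  obtain ⟨M, rfl⟩ := hker N (by rw [← h₂, zero_mul])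
  refine ⟨M, D, ?_, by simpa using h₁⟩
  rintro ⟨c, rfl⟩
  exact h₀ (by rw [map_mul, hp, zero_mul])

/-- A congruence of fractions modulo `m` can be checked on prime power factors of `m`. -/
lemma ratCongr_of_divBy [UniqueFactorizationMonoid R] {m : R} {x y : FractionRing R}
    (h : ∀ P : R, (∀ (p : R) (e : ℕ), Prime p → DivBy p e (x - y) → p ^ e ∣ P) → m ∣ P) :
    RatCongr m x y := by
  obtain ⟨P, Q, hPQ, hxy⟩ := IsFractionRing.exists_reduced_fraction (A := R) (x - y)
  have hQ : (Q : R) ≠ 0 := nonZeroDivisors.coe_ne_zero Q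
  have hQ' : algebraMap R (FractionRing R) Q ≠ 0 := by
    rwa [Ne, map_eq_zero_iff _ (IsFractionRing.injective R _)]
  rw [IsFractionRing.mk'_eq_div] at hxy
  obtain ⟨N, rfl⟩ : m ∣ P := by
    refine h P fun p e hp ⟨N, D, h₀, h₁⟩ => ?_
    refine hp.pow_dvd_of_dvd_mul_right e h₀ ⟨N * Q, ?_⟩
    apply IsFractionRing.injective R (FractionRing R)
    rw [← hxy, div_mul_eq_mul_div, div_eq_iff hQ'] at h₁
    rw [map_mul, h₁, ← map_mul, mul_assoc]
  exact ⟨N, Q, hQ, fun c h₁ h₂ => hPQ (h₂.mul_right N) h₁, hxy.symm⟩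

end DivBy

/-! ### The difference of the two sides under each specialisation. -/

section Specialization

variable {L : Type*} [Field L] {φ : Poly →+* L} {q₀ a₀ : L}

/-- The double sum of the theorem. -/
def doubleSum (n : ℕ) : Rat2 :=
  ∑ k ∈ Finset.range n, ∑ j ∈ Finset.range (k + 1), cTerm aF qF j * cTerm aF qF (k - j)

lemma evalsTo_qF (h : φ qP = q₀) : EvalsTo φ qF q₀ := h ▸ evalsTo_algebraMap φ qP

lemma evalsTo_aF (h : φ aP = a₀) : EvalsTo φ aF a₀ := h ▸ evalsTo_algebraMap φ aP

lemma evalsTo_doubleSum {n : ℕ} {E : ℕ → L}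
    (h : ∀ k < n, EvalsTo φ (cTerm aF qF k) (E k)) :
    EvalsTo φ (doubleSum n) (∑ k ∈ Finset.range n, ∑ j ∈ Finset.range (k + 1), E j * E (k - j)) :=
  EvalsTo.sum fun k hk => EvalsTo.sum fun j hj => by
    rw [Finset.mem_range] at hk hj
    exact (h j (by omega)).mul (h (k - j) (by omega))

lemma qP_pow_ne_one {m : ℕ} (hm : 0 < m) : qP ^ m ≠ 1 := by
  intro h
  rw [qP, ← C_pow, ← C_1, C_inj] at h
  have := congrArg natDegree h
  simp at this
  omega

/-- Agreement of the two sides at `a = q ^ n` and at `a = q ^ (-n)`. -/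
lemma evalsTo_sub_of_pow (hq : φ qP = q₀) (ha : φ aP = a₀) (hq0 : q₀ ≠ 0)
    (hinj : Function.Injective fun i : ℕ => q₀ ^ i) {n N : ℕ} (hn : n = 2 * N + 1)
    (h : a₀ = q₀ ^ n ∨ a₀ = (q₀ ^ n)⁻¹) :
    EvalsTo φ (doubleSum n - qF ^ (1 - (n : ℤ)) * qInt qF n ^ 2) 0 := by
  have hQ := evalsTo_qF hq
  have hA := evalsTo_aF ha
  have h1 : ∀ i : ℕ, i ≠ 0 → 1 - q₀ ^ i ≠ 0 := fun i hi h =>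
    hi (hinj (by simpa using (sub_eq_zero.1 h).symm))
  have hpos : ∀ i : ℕ, 1 - q₀ ^ n * q₀ ^ (2 * i + 2) ≠ 0 := fun i => by
    rw [← pow_add]; exact h1 _ (by omega)
  have hneg : ∀ i : ℕ, 1 - (q₀ ^ n)⁻¹ * q₀ ^ (2 * i + 2) ≠ 0 := fun i h => by
    have := hinj ((inv_mul_eq_one₀ (pow_ne_zero n hq0)).1 (sub_eq_zero.1 h).symm)
    omega
  have hc : ∀ k, EvalsTo φ (cTerm aF qF k) (cTerm (q₀ ^ n) q₀ k) := fun k => by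
    -- Both cases have the same values, since `cTerm` is invariant under `a ↦ a⁻¹`.
    rcases h with rfl | rfl
    · exact hA.cTerm hQ (pow_ne_zero _ hq0) (fun i _ => hpos i) (fun i _ => hneg i)
        fun i _ => h1 _ (by omega)
    · rw [← cTerm_inv (q₀ ^ n)]
      exact hA.cTerm hQ (inv_ne_zero (pow_ne_zero _ hq0)) (fun i _ => hneg i)
        (fun i _ => by rw [inv_inv]; exact hpos i) fun i _ => h1 _ (by omega)
  have hsum := evalsTo_doubleSum (n := n) fun k _ => hc k
  obtain ⟨hz, he⟩ := sum_cTerm_eval hq0 hinj N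
  subst hn
  rw [sum_triangle_eq_sq fun i hi _ => hz i hi] at hsum
  have hR := ((hQ.zpow hq0 (1 - ((2 * N + 1 : ℕ) : ℤ))).mul ((hQ.qInt (2 * N + 1)).pow 2))
  convert hsum.sub hR using 1
  have e : (1 - ((2 * N + 1 : ℕ) : ℤ)) = -((2 * N : ℕ) : ℤ) := by push_cast; ring
  rw [e, zpow_neg, zpow_natCast, ← he]
  field_simp
  ring

/-- Behaviour of `cTerm` on blocks of length `d` at a root of unity of odd order `d`. -/
lemma exists_evalsTo_cTerm_block (hq : φ qP = q₀) (ha : φ aP = a₀) {d : ℕ} (hd : Odd d)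
    (hd1 : 1 < d) (hprim : IsPrimitiveRoot q₀ d) (ha0 : a₀ ≠ 0) (hne : ∀ i : ℕ, a₀ ≠ q₀ ^ i)
    [CharZero L] (l : ℕ) :
    ∃ w : L, ∀ r < d, EvalsTo φ (cTerm aF qF (l * d + r)) (w * cTerm a₀ q₀ r) := by
  have hQ := evalsTo_qF hq
  have hA := evalsTo_aF ha
  have hq0 : q₀ ≠ 0 := hprim.ne_zero (by omega)
  have hinv := one_sub_inv_mul_pow_ne_zero ha0 hne
  have hmul := one_sub_mul_pow_ne_zero hprim (by omega) hne
  -- A root of unity of odd order has no power equal to `-1`.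
  have hplus : ∀ m : ℕ, 1 + (φ qP) ^ m ≠ 0 := fun m h => by
    have h₁ : (q₀ ^ m) = -1 := by rw [hq] at h; linear_combination h
    have h₂ : (q₀ ^ m) ^ d = 1 := by rw [← pow_mul, mul_comm, pow_mul, hprim.pow_eq_one, one_pow]
    rw [h₁, hd.neg_one_pow] at h₂
    norm_num at h₂
  obtain ⟨v, hv⟩ := exists_evalsTo_vRatio_one (F := Rat2) (φ := φ) (r := qP)
    (fun m hm => qP_pow_ne_one hm) hplus (l * d)
  change EvalsTo φ (QSuper.vRatio 1 qF (l * d)) v at hv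
  -- The block factor is the product of the ratios at index `l d`. At `a = 1` that ratio can be
  -- formally `0/0` at `q₀`, so its value `v` comes from the Gaussian binomial form.
  refine ⟨vRatio a₀ q₀ (l * d) * vRatio a₀⁻¹ q₀ (l * d) * v ^ 2, fun r hr => ?_⟩
  have hper : q₀ ^ (2 * (l * d)) = 1 := by
    rw [show 2 * (l * d) = d * (2 * l) by ring, pow_mul, hprim.pow_eq_one, one_pow]
  have hshift : ∀ {x : Rat2} {x₀ : L}, EvalsTo φ x x₀ →
      EvalsTo φ (x * qF ^ (2 * (l * d))) x₀ := fun {x x₀} hx => by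
    simpa [hper] using hx.mul (hQ.pow (2 * (l * d)))
  have hI : qInt q₀ (4 * (l * d + r) + 1) = qInt q₀ (4 * r + 1) := by
    apply mul_right_cancel₀ (one_sub_ne_zero_of_isPrimitiveRoot hprim hd1)
    rw [qInt_mul_one_sub, qInt_mul_one_sub,
      show 4 * (l * d + r) + 1 = 2 * (l * d) + 2 * (l * d) + (4 * r + 1) by ring, pow_add, pow_add,
      hper, one_mul, one_mul]
  have hE := (hQ.qInt (4 * (l * d + r) + 1)).mul
    (((((hA.vRatio hQ (k := l * d) fun i _ => hmul _)).mul
        ((hshift hA).vRatio hQ (k := r) fun i _ => hmul _)).mul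
      ((((hA.inv ha0).vRatio hQ (k := l * d) fun i _ => hinv _)).mul
        ((hshift (hA.inv ha0)).vRatio hQ (k := r) fun i _ => hinv _))).mul
      ((hv.mul ((hshift (evalsTo_one φ)).vRatio hQ (k := r)
        fun i hi => by rw [one_mul]; exact one_sub_pow_ne_zero_of_odd hprim hd (by omega))).pow 2))
  rw [cTerm_eq, vRatio_add, vRatio_add, vRatio_add, cTerm_eq]
  rw [hI] at hE
  convert hE using 1
  ring

/-- Both sides vanish at a nontrivial root of unity of order dividing `n`. -/
lemma evalsTo_sub_of_root (hq : φ qP = q₀) (ha : φ aP = a₀) {d n : ℕ} (hd : Odd d)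
    (hd1 : 1 < d) (hprim : IsPrimitiveRoot q₀ d) (ha0 : a₀ ≠ 0) (hne : ∀ i : ℕ, a₀ ≠ q₀ ^ i)
    [CharZero L] (hdn : d ∣ n) :
    EvalsTo φ (doubleSum n - qF ^ (1 - (n : ℤ)) * qInt qF n ^ 2) 0 := by
  have hQ := evalsTo_qF hq
  have hq0 : q₀ ≠ 0 := hprim.ne_zero (by omega)
  choose w hw using exists_evalsTo_cTerm_block hq ha hd hd1 hprim ha0 hne
  obtain ⟨l, rfl⟩ := hdn
  obtain ⟨N, hN⟩ := hd
  have hsum := evalsTo_doubleSum (φ := φ) (n := d * l)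
    (E := fun m => w (m / d) * cTerm a₀ q₀ (m % d)) fun m _ => by
      have := hw (m / d) (m % d) (Nat.mod_lt m (by omega))
      rwa [Nat.div_add_mod'] at this
  rw [mul_comm d l, sum_triangle_eq_zero hN
    (fun i hi _ => cTerm_eq_zero_of_lt (hN ▸ hprim.pow_eq_one) hi)
    (sum_cTerm_eq_zero ha0 (hN ▸ hprim) (by omega) hne)] at hsum
  have hI := qInt_eq_zero_of_isPrimitiveRoot hprim hd1 (Dvd.intro_left l rfl)
  have hR := (hQ.zpow hq0 (1 - ((l * d : ℕ) : ℤ))).mul ((hQ.qInt (l * d)).pow 2)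
  rw [hI] at hR
  rw [mul_comm d l]
  simpa using hsum.sub hR

/-- Both sides are divisible by the square of the prime `p` cutting out the primitive roots of
unity of order `n`. -/
lemma divBy_two_sub (hq : φ qP = q₀) (ha : φ aP = a₀) {n : ℕ} (hn : Odd n)
    (hn1 : 1 < n) (hprim : IsPrimitiveRoot q₀ n) (ha0 : a₀ ≠ 0) (hne : ∀ i : ℕ, a₀ ≠ q₀ ^ i)
    [CharZero L] {p : Poly} (hp : Prime p) (hpφ : φ p = 0) (hker : ∀ r, φ r = 0 → p ∣ r) :
    DivBy p 2 (doubleSum n - qF ^ (1 - (n : ℤ)) * qInt qF n ^ 2) := by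
  have hQ := evalsTo_qF hq
  have hA := evalsTo_aF ha
  have hq0 : q₀ ≠ 0 := hprim.ne_zero (by omega)
  obtain ⟨w, hw⟩ := exists_evalsTo_cTerm_block hq ha hn hn1 hprim ha0 hne 0
  simp only [zero_mul, zero_add] at hw
  obtain ⟨N, hN⟩ := id hn
  have hint : ∀ k < n, DivBy p 0 (cTerm aF qF k) := fun k hk => (hw k hk).divBy_zero hpφ
  have hS : DivBy p 1 (∑ k ∈ Finset.range (N + 1), cTerm aF qF k) := by
    refine EvalsTo.divBy_one hpφ hker ?_
    have := EvalsTo.sum (φ := φ) (s := Finset.range (N + 1)) fun k hk =>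
      hw k (by rw [Finset.mem_range] at hk; omega)
    rwa [← Finset.mul_sum, sum_cTerm_eq_zero ha0 (hN ▸ hprim) (by omega) hne, mul_zero] at this
  have hinv := one_sub_inv_mul_pow_ne_zero ha0 hne
  have hmul := one_sub_mul_pow_ne_zero hprim (by omega) hne
  have htwo : ∀ k, N < k → k < n → DivBy p 2 (cTerm aF qF k) := fun k hk hkn => by
    -- For `k < n` with `n` odd, `(q²;q²)_k` survives at `q₀`, while `k > N` makes `(q;q²)_k`
    -- vanish. The ratio is divisible by `p`, and it occurs squared.
    have hv := (evalsTo_one (F := Rat2) φ).vRatio hQ (k := k)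
      fun i hi => by rw [one_mul]; exact one_sub_pow_ne_zero_of_odd hprim hn (by omega)
    rw [vRatio_one_eq_zero_of_lt (q := q₀) (hN ▸ hprim.pow_eq_one) hk] at hv
    have hv1 := hv.divBy_one hpφ hker
    have hrest := ((hQ.qInt (4 * k + 1)).mul ((hA.vRatio hQ (k := k) fun i _ => hmul _).mul
      ((hA.inv ha0).vRatio hQ (k := k) fun i _ => hinv _))).divBy_zero hpφ
    have := hrest.mul hp (hv1.mul hp hv1)
    rw [cTerm_eq]
    convert this using 1
    ring
  have hR : DivBy p 2 (qF ^ (1 - (n : ℤ)) * qInt qF n ^ 2) := by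
    have h₁ := hQ.qInt n
    rw [qInt_eq_zero_of_isPrimitiveRoot hprim hn1 dvd_rfl] at h₁
    have h₂ := h₁.divBy_one hpφ hker
    have := ((hQ.zpow hq0 (1 - (n : ℤ))).divBy_zero hpφ).mul hp (h₂.mul hp h₂)
    rw [pow_two]
    convert this using 1
  refine DivBy.sub hp ?_ hR
  rw [doubleSum, hN]
  exact divBy_two_sum_triangle hp (fun k hk => hint k (by omega))
    (fun k hk hk' => htwo k hk (by omega)) hS

end Specialization

/-! ### Kernels of the specialisations and the divisibility by each prime. -/

section Kernel

lemma isPrimitive_of_coeff_isUnit {p : Poly} (i : ℕ) (h : IsUnit (p.coeff i)) : p.IsPrimitive :=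
  fun r hr => isUnit_of_dvd_unit ((C_dvd_iff_dvd_coeff r p).1 hr i) h

/-- Elements of `ℚ[q][a]` vanishing at a point `a₀` of `ℚ(q)` are divisible by every primitive
polynomial that becomes a multiple of `a - a₀` over `ℚ(q)`. -/
lemma dvd_of_eval₂_eq_zero {p r : Poly} (hp : p.IsPrimitive) {a₀ c : FractionRing ℚ[X]}
    (hc : c ≠ 0) (h : p.map (algebraMap ℚ[X] (FractionRing ℚ[X])) = C c * (X - C a₀))
    (hr : r.eval₂ (algebraMap ℚ[X] (FractionRing ℚ[X])) a₀ = 0) : p ∣ r := by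
  -- Gauss's lemma: a primitive polynomial may be tested for divisibility over `ℚ(q)`.
  refine hp.dvd_of_fraction_map_dvd_fraction_map (K := FractionRing ℚ[X]) ?_
  rw [h, (isUnit_C.2 (isUnit_iff_ne_zero.2 hc)).mul_left_dvd, dvd_iff_isRoot, IsRoot.def,
    eval_map, hr]

lemma prime_aP_sub (n : ℕ) : Prime (aP - qP ^ n) := by
  rw [aP, qP, ← C_pow]; exact prime_X_sub_C _

lemma isPrimitive_one_sub (n : ℕ) : (1 - aP * qP ^ n).IsPrimitive :=
  isPrimitive_of_coeff_isUnit 0 (by simp [aP])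

lemma prime_one_sub (n : ℕ) : Prime (1 - aP * qP ^ n) := by
  have : (1 - aP * qP ^ n) = C (-(X ^ n : ℚ[X])) * X + C 1 := by
    rw [aP, qP, ← C_pow, C_neg, C_1]; ring
  rw [this]
  exact (irreducible_C_mul_X_add_C (neg_ne_zero.2 (pow_ne_zero n X_ne_zero))
    isRelPrime_one_right).prime

lemma prime_C_cyclotomic {d : ℕ} (hd : 0 < d) : Prime (C (cyclotomic d ℚ) : Poly) :=
  prime_C_iff.2 (cyclotomic.irreducible_rat hd).prime

lemma pow_X_injective :
    Function.Injective fun i : ℕ => (algebraMap ℚ[X] (FractionRing ℚ[X]) X) ^ i := by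
  intro i j h
  simp only [← map_pow] at h
  have := congrArg natDegree (IsFractionRing.injective ℚ[X] (FractionRing ℚ[X]) h)
  simpa using this

lemma algebraMap_X_ne_zero : algebraMap ℚ[X] (FractionRing ℚ[X]) X ≠ 0 := by
  rw [Ne, map_eq_zero_iff _ (IsFractionRing.injective _ _)]; exact X_ne_zero

lemma divBy_aP_sub {n : ℕ} (hn : Odd n) :
    DivBy (aP - qP ^ n) 1 (doubleSum n - qF ^ (1 - (n : ℤ)) * qInt qF n ^ 2) := by
  obtain ⟨N, hN⟩ := hn
  let f := algebraMap ℚ[X] (FractionRing ℚ[X])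
  have hq : eval₂RingHom f (f X ^ n) qP = f X := by simp [qP]
  have ha : eval₂RingHom f (f X ^ n) aP = f X ^ n := by simp [aP]
  refine EvalsTo.divBy_one (φ := eval₂RingHom f (f X ^ n)) ?_ (fun r hr => ?_)
    (evalsTo_sub_of_pow hq ha algebraMap_X_ne_zero pow_X_injective hN (Or.inl rfl))
  · rw [map_sub, map_pow, hq, ha, sub_self]
  · refine dvd_of_eval₂_eq_zero ?_ one_ne_zero ?_ hr
    · rw [aP, qP, ← C_pow]; exact (monic_X_sub_C _).isPrimitive
    · simp [aP, qP, f]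

lemma divBy_one_sub {n : ℕ} (hn : Odd n) :
    DivBy (1 - aP * qP ^ n) 1 (doubleSum n - qF ^ (1 - (n : ℤ)) * qInt qF n ^ 2) := by
  obtain ⟨N, hN⟩ := hn
  let f := algebraMap ℚ[X] (FractionRing ℚ[X])
  have h0 : f X ^ n ≠ 0 := pow_ne_zero n algebraMap_X_ne_zero
  have hq : eval₂RingHom f (f X ^ n)⁻¹ qP = f X := by simp [qP]
  have ha : eval₂RingHom f (f X ^ n)⁻¹ aP = (f X ^ n)⁻¹ := by simp [aP]
  refine EvalsTo.divBy_one (φ := eval₂RingHom f (f X ^ n)⁻¹) ?_ (fun r hr => ?_)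
    (evalsTo_sub_of_pow hq ha algebraMap_X_ne_zero pow_X_injective hN (Or.inr rfl))
  · rw [map_sub, map_mul, map_pow, hq, ha, map_one, inv_mul_cancel₀ h0, sub_self]
  · refine dvd_of_eval₂_eq_zero (isPrimitive_one_sub n) (neg_ne_zero.2 h0) ?_ hr
    have e : (C (f X ^ n) * C (f X ^ n)⁻¹ : (FractionRing ℚ[X])[X]) = 1 := by
      rw [← C_mul, mul_inv_cancel₀ h0, C_1]
    have e' : (1 - aP * qP ^ n).map f = 1 - X * C (f X ^ n) := by
      simp [aP, qP]
    rw [e', C_neg]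
    linear_combination -e

/-- Evaluation of `q` at a complex number `ζ`, with values in `ℂ(a)`. -/
def evalRoot (ζ : ℂ) : Poly →+* FractionRing ℂ[X] :=
  (algebraMap ℂ[X] (FractionRing ℂ[X])).comp (mapRingHom (aeval (R := ℚ) ζ).toRingHom)

/-- The map acts on the coefficients in `a`, and `Φ_d` is the minimal polynomial of `ζ` over `ℚ`. -/
lemma evalRoot_eq_zero_iff {ζ : ℂ} {d : ℕ} (hd : 0 < d) (hζ : IsPrimitiveRoot ζ d) (r : Poly) :
    evalRoot ζ r = 0 ↔ C (cyclotomic d ℚ) ∣ r := by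
  rw [evalRoot, RingHom.comp_apply, map_eq_zero_iff _ (IsFractionRing.injective _ _),
    C_dvd_iff_dvd_coeff, Polynomial.ext_iff]
  refine forall_congr' fun i => ?_
  rw [coe_mapRingHom, coeff_map, coeff_zero, cyclotomic_eq_minpoly_rat hζ hd]
  exact minpoly.dvd_iff.symm

lemma divBy_cyclotomic {n d : ℕ} (hn : Odd n) (hd1 : 1 < d) (hdn : d ∣ n) :
    DivBy (C (cyclotomic d ℚ)) 1 (doubleSum n - qF ^ (1 - (n : ℤ)) * qInt qF n ^ 2) ∧
    DivBy (C (cyclotomic n ℚ)) 2 (doubleSum n - qF ^ (1 - (n : ℤ)) * qInt qF n ^ 2) := by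
  have hinj := IsFractionRing.injective ℂ[X] (FractionRing ℂ[X])
  have hinjC : Function.Injective ((algebraMap ℂ[X] (FractionRing ℂ[X])).comp C) :=
    hinj.comp C_injective
  have : CharZero (FractionRing ℂ[X]) := charZero_of_injective_ringHom hinjC
  have hq : ∀ ζ, evalRoot ζ qP = (algebraMap ℂ[X] (FractionRing ℂ[X])).comp C ζ := fun ζ => by
    simp [evalRoot, qP]
  have ha : ∀ ζ, evalRoot ζ aP = algebraMap ℂ[X] (FractionRing ℂ[X]) X := fun ζ => by
    simp [evalRoot, aP]
  have ha0 : algebraMap ℂ[X] (FractionRing ℂ[X]) X ≠ 0 := by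
    rw [Ne, map_eq_zero_iff _ hinj]; exact X_ne_zero
  have hne : ∀ ζ (i : ℕ), algebraMap ℂ[X] (FractionRing ℂ[X]) X ≠
      ((algebraMap ℂ[X] (FractionRing ℂ[X])).comp C ζ) ^ i := fun ζ i h => by
    rw [← map_pow, RingHom.comp_apply] at h
    exact X_ne_C _ (hinj h)
  have hn0 : 0 < n := hn.pos
  have hn1 : 1 < n := hd1.trans_le (Nat.le_of_dvd hn0 hdn)
  constructor
  · have hζ := Complex.isPrimitiveRoot_exp d (by omega)
    have hk := evalRoot_eq_zero_iff (by omega) hζ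
    exact EvalsTo.divBy_one ((hk _).2 dvd_rfl) (fun r => (hk r).1)
      (evalsTo_sub_of_root (hq _) (ha _) (hn.of_dvd_nat hdn) hd1 (hζ.map_of_injective hinjC) ha0
        (hne _) hdn)
  · have hζ := Complex.isPrimitiveRoot_exp n (by omega)
    have hk := evalRoot_eq_zero_iff (by omega) hζ
    exact divBy_two_sub (hq _) (ha _) hn hn1 (hζ.map_of_injective hinjC) ha0 (hne _)
      (prime_C_cyclotomic hn0) ((hk _).2 dvd_rfl) (fun r => (hk r).1)

end Kernel

/-! ### Factorisation of the modulus into relatively prime pieces. -/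

section Modulus

/-- As `[n]` is the product of `Φ_d` over `d ∣ n`, `d > 1`, it contributes one of the two factors
`Φ_n`. -/
lemma modulus_eq {n : ℕ} (hn : 1 < n) :
    modulus n = (∏ d ∈ (n.divisors.erase 1).erase n, C (cyclotomic d ℚ)) *
      C (cyclotomic n ℚ) ^ 2 * (1 - aP * qP ^ n) * (aP - qP ^ n) := by
  have h₁ : qInt qP n = C (qInt X n) := (map_qInt C X n).symm
  have h₂ : aeval qP (cyclotomic n ℚ) = C (cyclotomic n ℚ) := by
    rw [qP, ← algebraMap_eq, aeval_algebraMap_apply, aeval_X_left_apply]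
  have h₃ : qInt X n = ∏ d ∈ n.divisors.erase 1, cyclotomic d ℚ :=
    (prod_cyclotomic_eq_geom_sum (by omega) ℚ).symm
  have hmem : n ∈ n.divisors.erase 1 :=
    Finset.mem_erase.2 ⟨hn.ne', Nat.mem_divisors_self n (by omega)⟩
  rw [modulus, h₁, h₂, h₃, ← Finset.prod_erase_mul _ _ hmem, C_mul, map_prod]
  ring

/-- A primitive polynomial in `a` has no nonunit divisor free of `a`. -/
lemma isRelPrime_C_of_isPrimitive {f : ℚ[X]} {p : Poly} (hp : p.IsPrimitive)
    (hprime : Prime (C f : Poly)) : IsRelPrime (C f) p := by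
  rw [hprime.irreducible.isRelPrime_iff_not_dvd]
  intro h
  exact hprime.not_isUnit (isUnit_C.2 (hp f h))

/-- Divisibility by the modulus is checked on its prime power factors. -/
lemma modulus_dvd {n : ℕ} (hn : 1 < n) {P : Poly}
    (h₁ : ∀ d, 1 < d → d ∣ n → C (cyclotomic d ℚ) ∣ P) (h₂ : C (cyclotomic n ℚ) ^ 2 ∣ P)
    (h₃ : 1 - aP * qP ^ n ∣ P) (h₄ : aP - qP ^ n ∣ P) : modulus n ∣ P := by
  rw [modulus_eq hn]
  have hcop : ∀ {i j : ℕ}, i ≠ j →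
      IsRelPrime (C (cyclotomic i ℚ) : Poly) (C (cyclotomic j ℚ)) := fun hij =>
    ((cyclotomic.isCoprime_rat hij).map (C : ℚ[X] →+* Poly)).isRelPrime
  have hmem : ∀ {d}, d ∈ (n.divisors.erase 1).erase n → d ≠ n ∧ 1 < d ∧ d ∣ n := fun {d} hd => by
    simp only [Finset.mem_erase, Nat.mem_divisors] at hd
    have := Nat.pos_of_dvd_of_pos hd.2.2.1 (by omega)
    exact ⟨hd.1, by omega, hd.2.2.1⟩
  have hprod : (∏ d ∈ (n.divisors.erase 1).erase n, C (cyclotomic d ℚ)) ∣ P :=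
    Finset.prod_dvd_of_isRelPrime (fun i _ j _ hij => hcop hij)
      fun d hd => h₁ d (hmem hd).2.1 (hmem hd).2.2
  have hrel : ∀ p : Poly, p.IsPrimitive →
      IsRelPrime ((∏ d ∈ (n.divisors.erase 1).erase n, C (cyclotomic d ℚ)) *
        C (cyclotomic n ℚ) ^ 2) p := fun p hp =>
    IsRelPrime.mul_left (IsRelPrime.prod_left fun d hd => isRelPrime_C_of_isPrimitive hp
        (prime_C_cyclotomic (by have := (hmem hd).2.1; omega)))
      (isRelPrime_C_of_isPrimitive hp (prime_C_cyclotomic (by omega))).pow_left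
  have hab : IsRelPrime (1 - aP * qP ^ n) (aP - qP ^ n) := by
    refine IsRelPrime.symm ?_
    rw [(prime_aP_sub n).irreducible.isRelPrime_iff_not_dvd, aP, qP, ← C_pow, dvd_iff_isRoot]
    intro h
    -- Substituting `a = q^n` in the other factor leaves `1 - q^(2n)`, which is nonzero at `q = 0`.
    have h' : (1 : ℚ[X]) - X ^ n * X ^ n = 0 := by simpa using h
    have h'' := congrArg (eval 0) h'
    simp [show n ≠ 0 by omega] at h''
  refine IsRelPrime.mul_dvd (IsRelPrime.mul_left (hrel _ ?_) hab)
    (IsRelPrime.mul_dvd (hrel _ (isPrimitive_one_sub n)) (IsRelPrime.mul_dvd ?_ hprod h₂) h₃) h₄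
  · rw [aP, qP, ← C_pow]; exact (monic_X_sub_C _).isPrimitive
  · exact IsRelPrime.prod_left fun d hd => (hcop (hmem hd).1).pow_right

end Modulus

end QSuper

end

theorem mainTheorem6 (n : ℕ) (hn : Odd n) :
    QSuper.RatCongr (QSuper.modulus n)
      (∑ k ∈ Finset.range n, ∑ j ∈ Finset.range (k + 1),
        QSuper.cTerm QSuper.aF QSuper.qF j * QSuper.cTerm QSuper.aF QSuper.qF (k - j))
      (QSuper.qF ^ (1 - (n : ℤ)) * QSuper.qInt QSuper.qF n ^ 2) := by
  obtain rfl | hn1 : n = 1 ∨ 1 < n := by have := hn.pos; omega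
  -- For `n = 1` both sides equal `1`.
  · refine ⟨0, 1, one_ne_zero, isRelPrime_one_left, ?_⟩
    simp [QSuper.cTerm_eq, QSuper.qInt]
  · refine QSuper.ratCongr_of_divBy fun P hP => ?_
    refine QSuper.modulus_dvd hn1 (fun d hd hdn => ?_) ?_ ?_ ?_
    · simpa using hP _ 1 (QSuper.prime_C_cyclotomic (by omega))
        (QSuper.divBy_cyclotomic hn hd hdn).1
    · exact hP _ 2 (QSuper.prime_C_cyclotomic (by omega))
        (QSuper.divBy_cyclotomic hn hn1 dvd_rfl).2
    · simpa using hP _ 1 (QSuper.prime_one_sub n) (QSuper.divBy_one_sub hn)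
    · simpa using hP _ 1 (QSuper.prime_aP_sub n) (QSuper.divBy_aP_sub hn)
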